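/- Let $G$ be a locally compact Hausdorff group and $K$ a compact subgroup with normalized Haar measure $\omega$. Let $\mathcal C(G)$ be the space of continuous functions $G\to\mathbb C$ with uniform convergence on compact sets; its dual, with the weak* topology, is the space $\mathcal M_c(G)$ of compactly supported complex measures, with convolution $\langle\mu*\nu,f\rangle=\int\int f(xy)\,d\mu(x)\,d\nu(y)$ and action $(\mu*f)(x)=\int f(y^{-1}x)\,d\mu(y)$. Put $f^{\#}(x)=\int_K\int_K f(kxl)\,d\omega(k)\,d\omega(l)$ and $\langle\mu^{\#},f\rangle=\langle\mu,f^{\#}\rangle$. Let $\mathcal C(G//K)=\{f: f(kxl)=f(x)\ \text{for all } k,l\in K,\ x\in G\}$, and let $\mathcal A=\mathcal M_c(G//K)=\{\mu:\mu=\mu^{\#}\}$, an algebra with unit $\delta_e^{\#}$ (which acts on $\mathcal C(G//K)$ as $\delta_e$). Assume that $(G,K)$ is a Gelfand pair, that is, $\mathcal A$ is commutative. A $K$-variety is a closed linear subspace of $\mathcal C(G//K)$ invariant under all $K$-translations $\tau_yf=\delta_{y^{-1}}^{\#}*f$, $y\in G$; $\tau(\varphi)$ is the smallest $K$-variety containing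 $\varphi$. For a $K$-variety $V$ let $\mathrm{Ann}\,V=\{\mu\in\mathcal A:\mu*f=0\ \text{for all } f\in V\}$. A $K$-spherical function is a nonzero $s\in\mathcal C(G//K)$ with $\int_K s(xky)\,d\omega(k)=s(x)s(y)$ for all $x,y$; put $D_{s;y}=\delta_{y^{-1}}^{\#}-s(y)\,\delta_e^{\#}$. A $K$-spherical monomial is a $\varphi\in\mathcal C(G//K)$ such that $\tau(\varphi)$ is finite dimensional and, for some $K$-spherical function $s$ and some $n\in\mathbb N$, $D_{s;y_1}*\dots*D_{s;y_{n+1}}*\varphi=0$ for all $y_1,\dots,y_{n+1}\in G$. The $K$-variety $V$ is $K$-synthesizable if the $K$-spherical monomials belonging to $V$ span a dense subspace of $V$. A maximal ideal of $\mathcal A$ is exponential if it is the kernel of a continuous algebra homomorphism of $\mathcal A$ onto $\mathbb C$; for such $M$, $M^{n+1}$ denotes the closed power, i.e. the closure of the linear span of all products of $n+1$ elements of $M$. Theorem. Let $V$ be a nonzero $K$-variety. Suppose that $\mathcal A/M^{n+1}$ is finite dimensional for every exponential maximal ideal $M\supseteq\mathrm{Ann}\,V$ and every $n\in\mathbb N$.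 Then $V$ is $K$-synthesizable if and only if $$\mathrm{Ann}\,V=\bigcap_{M}\ \bigcap_{n\in\mathbb N}\bigl(\mathrm{Ann}\,V+M^{n+1}\bigr),\qquad(*)$$ where $M$ runs over all exponential maximal ideals containing $\mathrm{Ann}\,V$. Moreover, without the supposition on the quotients: if $V$ is $K$-synthesizable then $(*)$ holds; and if $(*)$ holds with the intersection restricted to those pairs $(M,n)$ for which $\mathcal A/M^{n+1}$ is finite dimensional, then $V$ is $K$-synthesizable. -/

import Mathlib

open MeasureTheory

namespace SphericalSynthesis

noncomputable section

section Slices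

/-! ### Applying a functional in one of two variables -/

variable {X Y Z : Type*} [TopologicalSpace X] [TopologicalSpace Y] [TopologicalSpace Z]
  [LocallyCompactSpace X] [LocallyCompactSpace Y]

/-- For a continuous map `p : X × Y → Z` and a continuous linear functional `ν` on `C(Y, ℂ)`, the
operator sending `f : C(Z, ℂ)` to the continuous function `x ↦ ν (y ↦ f (p (x, y)))`. -/
def slice (p : C(X × Y, Z)) (ν : C(Y, ℂ) →L[ℂ] ℂ) : C(Z, ℂ) →L[ℂ] C(X, ℂ) where
  toFun f := ContinuousMap.comp ⟨fun g : C(Y, ℂ) => ν g, map_continuous ν⟩ (f.comp p).curry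
  map_add' f g := by
    ext x
    exact map_add ν ((f.comp p).curry x) ((g.comp p).curry x)
  map_smul' c f := by
    ext x
    exact map_smul ν c ((f.comp p).curry x)
  cont := (ContinuousMap.continuous_postcomp _).comp
    (ContinuousMap.continuous_curry.comp (ContinuousMap.continuous_precomp p))

theorem slice_apply (p : C(X × Y, Z)) (ν : C(Y, ℂ) →L[ℂ] ℂ) (f : C(Z, ℂ)) (x : X) :
    slice p ν f x = ν ((f.comp p).curry x) := rfl

end Slices

section Fubini

variable {X Y : Type*} [TopologicalSpace X] [TopologicalSpace Y]

/-- A continuous linear functional on `C(X, ℂ)` factors through the restriction to a compact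
set. -/
theorem exists_compact_factor (μ : C(X, ℂ) →L[ℂ] ℂ) :
    ∃ L : Set X, ∃ _ : CompactSpace L, ∃ μ' : C(L, ℂ) →L[ℂ] ℂ,
      ∀ f : C(X, ℂ), μ f = μ' (f.restrict L) := by
  have h0 : {f : C(X, ℂ) | ‖μ f‖ < 1} ∈ nhds (0 : C(X, ℂ)) := by
    apply (isOpen_lt (by fun_prop) continuous_const).mem_nhds
    simp
  have hb := nhds_basis_uniformity' (x := (0 : C(X, ℂ)))
    (Metric.uniformity_basis_dist (α := ℂ)).compactConvergenceUniformity
  rw [hb.mem_iff] at h0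
  obtain ⟨⟨L, ε⟩, ⟨hL, hε⟩, hsub⟩ := h0
  simp only at hL hε hsub
  have : CompactSpace L := isCompact_iff_compactSpace.mp hL
  let r : C(X, ℂ) →ₗ[ℂ] C(L, ℂ) :=
    { toFun := fun f => f.restrict L, map_add' := fun _ _ => rfl, map_smul' := fun _ _ => rfl }
  have hbound : ∀ f, ‖μ f‖ ≤ ε⁻¹ * ‖r f‖ := by
    intro f
    have key : ∀ t, ‖r f‖ < t → ‖μ f‖ ≤ ε⁻¹ * t := by
      intro t ht
      have ht0 : 0 < t := (norm_nonneg _).trans_lt ht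
      have hmem : ((ε / t : ℝ) : ℂ) • f ∈ {f : C(X, ℂ) | ‖μ f‖ < 1} := by
        apply hsub
        intro x hx
        have h1 : ‖f x‖ ≤ ‖r f‖ := (r f).norm_coe_le_norm ⟨x, hx⟩
        have h2 : ‖f x‖ < t := h1.trans_lt ht
        have h3 : ‖((ε / t : ℝ) : ℂ)‖ = ε / t := by
          rw [Complex.norm_real, Real.norm_of_nonneg (by positivity)]
        show dist ((0 : C(X, ℂ)) x) (((ε / t : ℝ) : ℂ) • f x) < ε
        rw [ContinuousMap.zero_apply, dist_zero_left, norm_smul, h3]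
        calc ε / t * ‖f x‖ < ε / t * t := by gcongr
          _ = ε := by field_simp
      have h3 : ‖((ε / t : ℝ) : ℂ)‖ = ε / t := by
        rw [Complex.norm_real, Real.norm_of_nonneg (by positivity)]
      rw [Set.mem_ofPred_eq, map_smul, norm_smul, h3] at hmem
      have : ‖μ f‖ = ε⁻¹ * t * (ε / t * ‖μ f‖) := by field_simp
      rw [this]
      exact mul_le_of_le_one_right (by positivity) hmem.le
    rw [← div_eq_inv_mul, le_div_iff₀ hε]
    apply le_of_forall_gt_imp_ge_of_dense
    intro t ht
    have := key t ht
    rwa [← div_eq_inv_mul, le_div_iff₀ hε] at this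
  have hker : LinearMap.ker r ≤ LinearMap.ker μ.toLinearMap := by
    intro f hf
    have h1 := hbound f
    rw [LinearMap.mem_ker.mp hf] at h1
    simpa using h1
  let g : LinearMap.range r →ₗ[ℂ] ℂ :=
    ((LinearMap.ker r).liftQ μ.toLinearMap hker).comp r.quotKerEquivRange.symm.toLinearMap
  have hg : ∀ f, g ⟨r f, LinearMap.mem_range_self r f⟩ = μ f := by
    intro f
    have : r.quotKerEquivRange.symm ⟨r f, LinearMap.mem_range_self r f⟩
        = (LinearMap.ker r).mkQ f := by
      rw [LinearEquiv.symm_apply_eq]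
      rfl
    show (LinearMap.ker r).liftQ μ.toLinearMap hker (r.quotKerEquivRange.symm _) = _
    rw [this]
    rfl
  let gc : StrongDual ℂ (LinearMap.range r) := g.mkContinuous ε⁻¹ (by
    rintro ⟨_, f, rfl⟩
    rw [hg]
    exact hbound f)
  obtain ⟨μ', hμ', -⟩ := exists_extension_norm_eq (LinearMap.range r) gc
  refine ⟨L, this, μ', fun f => ?_⟩
  exact ((hμ' ⟨r f, LinearMap.mem_range_self r f⟩).trans (hg f)).symm

/-- A continuous linear functional on `C(X, ℂ)` commutes with integration over a compact space of
parameters. -/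
theorem functional_integral_comm [CompactSpace Y] [MeasurableSpace Y] [BorelSpace Y]
    (ω : Measure Y) [IsFiniteMeasure ω] (μ : C(X, ℂ) →L[ℂ] ℂ) (F : C(Y, C(X, ℂ)))
    (g : C(X, ℂ)) (hg : ∀ x, g x = ∫ k, F k x ∂ω) :
    μ g = ∫ k, μ (F k) ∂ω := by
  obtain ⟨L, hL, μ', hμ'⟩ := exists_compact_factor μ
  have hF : Continuous fun k => (F k).restrict L :=
    (ContinuousMap.continuous_precomp (⟨Subtype.val, continuous_subtype_val⟩ : C(L, X))).comp
      F.continuous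
  have hint : Integrable (fun k => (F k).restrict L) ω :=
    hF.integrable_of_hasCompactSupport (HasCompactSupport.of_compactSpace _)
  have hgr : g.restrict L = ∫ k, (F k).restrict L ∂ω := by
    ext x
    rw [ContinuousMap.integral_apply hint]
    exact hg x
  simp only [hμ', hgr]
  exact (μ'.integral_comp_comm hint).symm

end Fubini

section Pair


variable {G : Type*} [Group G] [TopologicalSpace G] [IsTopologicalGroup G] [LocallyCompactSpace G]

/-! ### Compactly supported measures, convolution -/

variable (G) in
/-- The space `M_c(G)` of compactly supported complex measures on `G`, as the dual of `C(G)`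
(uniform convergence on compact sets), with the weak-* topology. -/
def CompactMeasure : Type _ := WeakDual ℂ C(G, ℂ)

namespace CompactMeasure

instance : AddCommGroup (CompactMeasure G) :=
  inferInstanceAs (AddCommGroup (WeakDual ℂ C(G, ℂ)))

instance : Module ℂ (CompactMeasure G) :=
  inferInstanceAs (Module ℂ (WeakDual ℂ C(G, ℂ)))

instance : TopologicalSpace (CompactMeasure G) :=
  inferInstanceAs (TopologicalSpace (WeakDual ℂ C(G, ℂ)))

instance : IsTopologicalAddGroup (CompactMeasure G) :=
  inferInstanceAs (IsTopologicalAddGroup (WeakDual ℂ C(G, ℂ)))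

instance : ContinuousSMul ℂ (CompactMeasure G) :=
  inferInstanceAs (ContinuousSMul ℂ (WeakDual ℂ C(G, ℂ)))

instance : FunLike (CompactMeasure G) C(G, ℂ) ℂ :=
  inferInstanceAs (FunLike (WeakDual ℂ C(G, ℂ)) C(G, ℂ) ℂ)

instance : ContinuousLinearMapClass (CompactMeasure G) ℂ C(G, ℂ) ℂ :=
  inferInstanceAs (ContinuousLinearMapClass (WeakDual ℂ C(G, ℂ)) ℂ C(G, ℂ) ℂ)

/-- The measure given by a continuous linear functional on `C(G)`. -/
def of (Λ : C(G, ℂ) →L[ℂ] ℂ) : CompactMeasure G := StrongDual.toWeakDual Λ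

/-- The continuous linear functional `f ↦ ⟨μ, f⟩`. -/
def toFunctional (μ : CompactMeasure G) : C(G, ℂ) →L[ℂ] ℂ :=
  WeakDual.toStrongDual (𝕜 := ℂ) (E := C(G, ℂ)) μ

end CompactMeasure

/-- The operator taking `f` to `x ↦ ∫ f (x y) dν(y)`. -/
def mulSlice (ν : CompactMeasure G) : C(G, ℂ) →L[ℂ] C(G, ℂ) :=
  slice ⟨fun p : G × G => p.1 * p.2, by fun_prop⟩ ν.toFunctional

theorem mulSlice_apply (ν : CompactMeasure G) (f : C(G, ℂ)) (x : G) :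
    mulSlice ν f x = ν (f.comp ⟨fun y => x * y, by fun_prop⟩) := rfl

/-- `⟨μ * ν, f⟩ = ∫∫ f (x y) dμ(x) dν(y)`. -/
def conv (μ ν : CompactMeasure G) : CompactMeasure G :=
  .of (μ.toFunctional.comp (mulSlice ν))

/-- `(μ * f)(x) = ∫ f (y⁻¹ x) dμ(y)`. -/
def convFun (μ : CompactMeasure G) (f : C(G, ℂ)) : C(G, ℂ) :=
  slice ⟨fun p : G × G => p.2⁻¹ * p.1, by fun_prop⟩ μ.toFunctional f

/-- The point mass at `y`. -/
def dirac (y : G) : CompactMeasure G :=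
  .of
    { toFun := fun f : C(G, ℂ) => f y
      map_add' := fun _ _ => rfl
      map_smul' := fun _ _ => rfl
      cont := continuous_eval_const y }

variable [T2Space G] [MeasurableSpace G] [BorelSpace G] (K : Subgroup G) [CompactSpace K]

/-! ### The compact subgroup and projections -/

/-- The normalized Haar measure of the compact subgroup `K`. -/
def haarK : Measure K := Measure.haarMeasure ⊤

instance : IsProbabilityMeasure (haarK K) :=
  ⟨by simpa [haarK] using Measure.haarMeasure_self (K₀ := (⊤ : TopologicalSpace.PositiveCompacts K))⟩

instance : (haarK K).IsMulLeftInvariant := by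
  unfold haarK; infer_instance

theorem integrable_haarK (f : C(K, ℂ)) : Integrable f (haarK K) :=
  f.continuous.integrable_of_hasCompactSupport (HasCompactSupport.of_compactSpace _)

/-- Integration over `K` as a functional on `C(K)`. -/
def intK : C(K, ℂ) →L[ℂ] ℂ :=
  LinearMap.mkContinuous
    { toFun := fun f : C(K, ℂ) => ∫ k, f k ∂(haarK K)
      map_add' := fun f g => integral_add (integrable_haarK K f) (integrable_haarK K g)
      map_smul' := fun c f => integral_smul c f } 1 (fun f => by
        rw [one_mul]
        refine (norm_integral_le_of_norm_le_const (C := ‖f‖)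
          (Filter.Eventually.of_forall f.norm_coe_le_norm)).trans ?_
        simp)

theorem intK_apply (f : C(K, ℂ)) : intK K f = ∫ k, f k ∂(haarK K) := rfl

/-- `x ↦ ∫ f (k x) dω(k)`. -/
def leftAvg : C(G, ℂ) →L[ℂ] C(G, ℂ) :=
  slice ⟨fun p : G × K => (p.2 : G) * p.1, by fun_prop⟩ (intK K)

/-- `x ↦ ∫ f (x k) dω(k)`. -/
def rightAvg : C(G, ℂ) →L[ℂ] C(G, ℂ) :=
  slice ⟨fun p : G × K => p.1 * (p.2 : G), by fun_prop⟩ (intK K)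

theorem leftAvg_apply (f : C(G, ℂ)) (x : G) :
    leftAvg K f x = ∫ k : K, f ((k : G) * x) ∂(haarK K) := rfl

theorem rightAvg_apply (f : C(G, ℂ)) (x : G) :
    rightAvg K f x = ∫ k : K, f (x * (k : G)) ∂(haarK K) := rfl

/-- The projection `f ↦ f^#` of functions. -/
def proj : C(G, ℂ) →L[ℂ] C(G, ℂ) := (leftAvg K).comp (rightAvg K)

theorem proj_apply (f : C(G, ℂ)) (x : G) :
    proj K f x = ∫ k : K, ∫ l : K, f ((k : G) * x * (l : G)) ∂(haarK K) ∂(haarK K) := rfl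

/-- The projection `μ ↦ μ^#` of measures, `⟨μ^#, f⟩ = ⟨μ, f^#⟩`. -/
def measProj (μ : CompactMeasure G) : CompactMeasure G :=
  .of (μ.toFunctional.comp (proj K))

theorem rightAvg_rightAvg (f : C(G, ℂ)) : rightAvg K (rightAvg K f) = rightAvg K f := by
  ext x
  simp only [rightAvg_apply]
  have : ∀ k : K, ∫ l : K, f (x * (k : G) * (l : G)) ∂(haarK K)
      = ∫ l : K, f (x * (l : G)) ∂(haarK K) := by
    intro k
    rw [← integral_mul_left_eq_self (μ := haarK K) (fun l : K => f (x * (l : G))) k]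
    simp [mul_assoc]
  simp [this]

theorem integral_swap_K (F : K → K → ℂ) (hF : Continuous (Function.uncurry F)) :
    ∫ k, ∫ l, F k l ∂(haarK K) ∂(haarK K) = ∫ l, ∫ k, F k l ∂(haarK K) ∂(haarK K) :=
  integral_integral_swap_of_hasCompactSupport hF (HasCompactSupport.of_compactSpace _)

theorem leftAvg_leftAvg (f : C(G, ℂ)) : leftAvg K (leftAvg K f) = leftAvg K f := by
  ext x
  simp only [leftAvg_apply]
  rw [integral_swap_K K (fun k l => f ((l : G) * ((k : G) * x))) (by unfold Function.uncurry; fun_prop)]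
  have : ∀ l : K, ∫ k : K, f ((l : G) * ((k : G) * x)) ∂(haarK K)
      = ∫ k : K, f ((k : G) * x) ∂(haarK K) := by
    intro l
    rw [← integral_mul_left_eq_self (μ := haarK K) (fun k : K => f ((k : G) * x)) l]
    simp [mul_assoc]
  simp [this]

theorem leftAvg_rightAvg (f : C(G, ℂ)) :
    leftAvg K (rightAvg K f) = rightAvg K (leftAvg K f) := by
  ext x
  simp only [leftAvg_apply, rightAvg_apply]
  rw [integral_swap_K K (fun k l => f ((k : G) * x * (l : G))) (by unfold Function.uncurry; fun_prop)]
  simp [mul_assoc]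

theorem proj_leftAvg (f : C(G, ℂ)) : proj K (leftAvg K f) = proj K f := by
  simp [proj, ← leftAvg_rightAvg, leftAvg_leftAvg]

theorem proj_rightAvg (f : C(G, ℂ)) : proj K (rightAvg K f) = proj K f := by
  simp [proj, rightAvg_rightAvg]

theorem proj_proj (f : C(G, ℂ)) : proj K (proj K f) = proj K f := by
  rw [show proj K (proj K f) = proj K (leftAvg K (rightAvg K f)) from rfl, proj_leftAvg,
    proj_rightAvg]

/-! ### The space `C(G//K)` and the algebra `M_c(G//K)` -/

/-- The space `C(G//K)` of `K`-invariant continuous functions. -/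
def KFun : Submodule ℂ C(G, ℂ) where
  carrier := {f | ∀ (x : G) (k l : K), f ((k : G) * x * (l : G)) = f x}
  add_mem' hf hg x k l := by
    simp only [ContinuousMap.add_apply]
    rw [hf x k l, hg x k l]
  zero_mem' _ _ _ := rfl
  smul_mem' c f hf x k l := by
    simp only [ContinuousMap.smul_apply]
    rw [hf x k l]

/-- The space `M_c(G//K)` of `K`-invariant measures, `⟨μ, f⟩ = ⟨μ, f^#⟩` for all `f`. -/
def KMeas : Submodule ℂ (CompactMeasure G) where
  carrier := {μ | ∀ f : C(G, ℂ), μ f = μ (proj K f)}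
  add_mem' := fun {μ ν} hμ hν f => by
    show μ f + ν f = μ (proj K f) + ν (proj K f)
    rw [hμ f, hν f]
  zero_mem' _ := rfl
  smul_mem' c μ hμ f := by
    show c • μ f = c • μ (proj K f)
    rw [hμ f]

variable {K}

theorem KMeas.apply_proj (μ : KMeas K) (f : C(G, ℂ)) :
    (μ : CompactMeasure G) (proj K f) = (μ : CompactMeasure G) f := (μ.2 f).symm

theorem KMeas.apply_leftAvg (μ : KMeas K) (f : C(G, ℂ)) :
    (μ : CompactMeasure G) (leftAvg K f) = (μ : CompactMeasure G) f := by
  rw [← KMeas.apply_proj μ, proj_leftAvg, KMeas.apply_proj μ]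

theorem KMeas.apply_rightAvg (μ : KMeas K) (f : C(G, ℂ)) :
    (μ : CompactMeasure G) (rightAvg K f) = (μ : CompactMeasure G) f := by
  rw [← KMeas.apply_proj μ, proj_rightAvg, KMeas.apply_proj μ]

theorem conv_apply (μ ν : CompactMeasure G) (f : C(G, ℂ)) :
    conv μ ν f = μ (mulSlice ν f) := rfl

theorem mulSlice_leftAvg (ν : CompactMeasure G) (f : C(G, ℂ)) :
    mulSlice ν (leftAvg K f) = leftAvg K (mulSlice ν f) := by
  ext x
  rw [leftAvg_apply, mulSlice_apply]
  refine functional_integral_comm (haarK K) ν.toFunctional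
    (ContinuousMap.curry
      (⟨fun p : K × G => f ((p.1 : G) * x * p.2), by fun_prop⟩ : C(K × G, ℂ))) _ ?_
  intro y
  show leftAvg K f (x * y) = _
  rw [leftAvg_apply]
  simp [mul_assoc]

theorem mulSlice_rightAvg (ν : KMeas K) (f : C(G, ℂ)) :
    mulSlice ν (rightAvg K f) = mulSlice ν f := by
  ext x
  rw [mulSlice_apply, mulSlice_apply, ← KMeas.apply_rightAvg ν (f.comp _)]
  congr 1
  ext y
  simp [rightAvg_apply, mul_assoc]

theorem rightAvg_mulSlice (μ : KMeas K) (f : C(G, ℂ)) :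
    rightAvg K (mulSlice μ f) = mulSlice μ f := by
  ext x
  rw [rightAvg_apply, mulSlice_apply, ← KMeas.apply_leftAvg μ (f.comp _)]
  refine (functional_integral_comm (haarK K) (μ : CompactMeasure G).toFunctional
    (ContinuousMap.curry
      (⟨fun p : K × G => f (x * (p.1 : G) * p.2), by fun_prop⟩ : C(K × G, ℂ))) _ ?_).symm
  intro y
  rw [leftAvg_apply]
  simp [mul_assoc]

theorem conv_mem (μ ν : KMeas K) : conv (μ : CompactMeasure G) ν ∈ KMeas K := by
  intro f
  rw [conv_apply, conv_apply, show proj K f = leftAvg K (rightAvg K f) from rfl, mulSlice_leftAvg,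
    KMeas.apply_leftAvg μ, mulSlice_rightAvg]

theorem measProj_mem (μ : CompactMeasure G) : measProj K μ ∈ KMeas K := by
  intro f
  show μ (proj K f) = μ (proj K (proj K f))
  rw [proj_proj]

variable (K) in
/-- The `K`-invariant measure `δ_y^#`. -/
def deltaK (y : G) : KMeas K := ⟨measProj K (dirac y), measProj_mem _⟩

theorem deltaK_apply (y : G) (f : C(G, ℂ)) :
    (deltaK K y : CompactMeasure G) f = proj K f y := rfl

instance : Mul (KMeas K) := ⟨fun μ ν => ⟨conv (μ : CompactMeasure G) ν, conv_mem μ ν⟩⟩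

/-- The unit of `M_c(G//K)`, `δ_e^#`; as a functional on `C(G//K)` it is `δ_e`. -/
instance : One (KMeas K) := ⟨deltaK K 1⟩

theorem KMeas.mul_apply (μ ν : KMeas K) (f : C(G, ℂ)) :
    ((μ * ν : KMeas K) : CompactMeasure G) f
      = (μ : CompactMeasure G) (mulSlice ν f) := rfl

theorem KMeas.add_apply (μ ν : KMeas K) (f : C(G, ℂ)) :
    ((μ + ν : KMeas K) : CompactMeasure G) f
      = (μ : CompactMeasure G) f + (ν : CompactMeasure G) f := rfl

theorem KMeas.smul_apply (c : ℂ) (μ : KMeas K) (f : C(G, ℂ)) :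
    ((c • μ : KMeas K) : CompactMeasure G) f = c * (μ : CompactMeasure G) f := rfl

theorem KMeas.one_apply (f : C(G, ℂ)) :
    ((1 : KMeas K) : CompactMeasure G) f = proj K f 1 := rfl

theorem KMeas.ext_apply {μ ν : KMeas K}
    (h : ∀ f : C(G, ℂ), (μ : CompactMeasure G) f = (ν : CompactMeasure G) f) : μ = ν :=
  Subtype.ext (DFunLike.ext _ _ h)

/-- The algebra `M_c(G//K)` with convolution as multiplication. -/
instance : Ring (KMeas K) :=
  { (inferInstance : AddCommGroup (KMeas K)), (inferInstance : Mul (KMeas K)),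
    (inferInstance : One (KMeas K)) with
    left_distrib := fun μ ν ρ => KMeas.ext_apply fun f => by
      rw [KMeas.add_apply, KMeas.mul_apply, KMeas.mul_apply, KMeas.mul_apply, ← map_add]
      rfl
    right_distrib := fun μ ν ρ => KMeas.ext_apply fun f => rfl
    zero_mul := fun μ => KMeas.ext_apply fun f => rfl
    mul_zero := fun μ => KMeas.ext_apply fun f => by
      rw [KMeas.mul_apply]
      exact map_zero (μ : CompactMeasure G)
    mul_assoc := fun μ ν ρ => KMeas.ext_apply fun f => by
      rw [KMeas.mul_apply, KMeas.mul_apply, KMeas.mul_apply]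
      congr 1
      ext x
      rw [mulSlice_apply, mulSlice_apply, KMeas.mul_apply]
      congr 1
      ext y
      rw [mulSlice_apply]
      show (ρ : CompactMeasure G) _ = (ρ : CompactMeasure G) _
      congr 1
      ext z
      simp [mul_assoc]
    one_mul := fun μ => KMeas.ext_apply fun f => by
      rw [KMeas.mul_apply, KMeas.one_apply, show proj K (mulSlice μ f)
        = leftAvg K (rightAvg K (mulSlice μ f)) from rfl, rightAvg_mulSlice, ← mulSlice_leftAvg,
        mulSlice_apply, ← KMeas.apply_leftAvg μ f]
      congr 1
      ext y
      simp
    mul_one := fun μ => KMeas.ext_apply fun f => by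
      rw [KMeas.mul_apply, ← KMeas.apply_rightAvg μ f]
      congr 1
      ext x
      rw [mulSlice_apply, KMeas.one_apply, ← rightAvg_rightAvg, proj_apply]
      simp [rightAvg_apply, mul_assoc] }

instance : Algebra ℂ (KMeas K) :=
  Algebra.ofModule
    (fun c μ ν => rfl)
    (fun c μ ν => KMeas.ext_apply fun f => by
      rw [KMeas.smul_apply, KMeas.mul_apply, KMeas.mul_apply]
      exact map_smul (μ : CompactMeasure G) c (mulSlice ν f))

theorem convFun_apply (μ : CompactMeasure G) (f : C(G, ℂ)) (x : G) :
    convFun μ f x = μ (f.comp ⟨fun y => y⁻¹ * x, by fun_prop⟩) := rfl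

theorem convFun_mul (μ ν : KMeas K) (f : C(G, ℂ)) :
    convFun ((μ * ν : KMeas K) : CompactMeasure G) f
      = convFun (μ : CompactMeasure G) (convFun (ν : CompactMeasure G) f) := by
  ext x
  rw [convFun_apply, convFun_apply, KMeas.mul_apply]
  congr 1
  ext y
  rw [mulSlice_apply]
  show _ = convFun (ν : CompactMeasure G) f (y⁻¹ * x)
  rw [convFun_apply]
  congr 1
  ext z
  simp [mul_assoc]

theorem convFun_zero (μ : CompactMeasure G) : convFun μ 0 = 0 := by
  simp [convFun]

variable (K)

/-- `(G, K)` is a Gelfand pair: the algebra `M_c(G//K)` is commutative. -/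
def IsGelfandPair : Prop := ∀ μ ν : KMeas K, μ * ν = ν * μ

/-! ### Varieties, annihilators, exponential maximal ideals -/

/-- The `K`-translation `τ_y f = δ_{y⁻¹}^# * f`. -/
def translate (y : G) (f : C(G, ℂ)) : C(G, ℂ) := convFun (deltaK K y⁻¹ : CompactMeasure G) f

/-- A `K`-variety: a closed `K`-translation invariant linear subspace of `C(G//K)`. -/
structure IsVariety (V : Submodule ℂ C(G, ℂ)) : Prop where
  le_KFun : V ≤ KFun K
  isClosed : IsClosed (V : Set C(G, ℂ))
  translate_mem : ∀ f ∈ V, ∀ y : G, translate K y f ∈ V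

/-- The `K`-variety `τ(f)` generated by `f`. -/
def generated (f : C(G, ℂ)) : Submodule ℂ C(G, ℂ) :=
  sInf {V | IsVariety K V ∧ f ∈ V}

/-- The annihilator `Ann V = {μ | μ * f = 0 for all f in V}` in `M_c(G//K)`. -/
def annihilator (V : Submodule ℂ C(G, ℂ)) : Ideal (KMeas K) where
  carrier := {μ | ∀ f ∈ V, convFun (μ : CompactMeasure G) f = 0}
  add_mem' := fun {μ ν} hμ hν f hf => by
    ext x
    have h1 := DFunLike.congr_fun (hμ f hf) x
    have h2 := DFunLike.congr_fun (hν f hf) x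
    rw [convFun_apply] at h1 h2 ⊢
    rw [KMeas.add_apply, h1, h2]
    simp
  zero_mem' _ _ := rfl
  smul_mem' ν μ hμ f hf := by
    rw [smul_eq_mul, convFun_mul, hμ f hf, convFun_zero]

variable {K}

/-- An exponential maximal ideal: a maximal ideal which is the kernel of a continuous algebra
homomorphism of `M_c(G//K)` onto `ℂ`. -/
def IsExponential (M : Ideal (KMeas K)) : Prop :=
  M.IsMaximal ∧ ∃ Φ : KMeas K →ₐ[ℂ] ℂ, Continuous Φ ∧ Function.Surjective Φ ∧
    M = RingHom.ker Φ

/-- The power `M^n` as a closed ideal: the closure of the linear span of the products of `n`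
elements of `M`. -/
def closedPower (M : Ideal (KMeas K)) (n : ℕ) : Submodule ℂ (KMeas K) :=
  ((M ^ n).restrictScalars ℂ).topologicalClosure

variable (K)

/-! ### Spherical functions, spherical monomials, synthesis -/

/-- A `K`-spherical function: nonzero, `K`-invariant, with `∫ s (x k y) dω(k) = s x * s y`. -/
structure IsSpherical (s : C(G, ℂ)) : Prop where
  mem_KFun : s ∈ KFun K
  ne_zero : s ≠ 0
  integral_eq : ∀ x y : G, ∫ k : K, s (x * (k : G) * y) ∂(haarK K) = s x * s y

/-- The modified `K`-spherical difference `D_{s;y} = δ_{y⁻¹}^# - s(y) δ_e`, where `δ_e` is the unit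
of `M_c(G//K)`. -/
def sphDiff (s : C(G, ℂ)) (y : G) : KMeas K := deltaK K y⁻¹ - s y • (1 : KMeas K)

/-- A generalized `K`-spherical monomial: `D_{s;y_1} * ⋯ * D_{s;y_{n+1}} * φ = 0` for some
`K`-spherical function `s`, some `n`, and all `y_1, …, y_{n+1}`. -/
structure IsGenMonomial (φ : C(G, ℂ)) : Prop where
  mem_KFun : φ ∈ KFun K
  exists_eq_zero : ∃ s : C(G, ℂ), IsSpherical K s ∧ ∃ n : ℕ, ∀ y : Fin (n + 1) → G,
    convFun ((List.ofFn fun i => sphDiff K s (y i)).prod : CompactMeasure G) φ = 0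

/-- A `K`-spherical monomial: a generalized one generating a finite dimensional `K`-variety. -/
def IsMonomial (φ : C(G, ℂ)) : Prop :=
  IsGenMonomial K φ ∧ FiniteDimensional ℂ (generated K φ)

/-- `V` is `K`-synthesizable: the `K`-spherical monomials in `V` span a dense subspace of `V`. -/
def IsSynthesizable (V : Submodule ℂ C(G, ℂ)) : Prop :=
  V ≤ (Submodule.span ℂ {φ | φ ∈ V ∧ IsMonomial K φ}).topologicalClosure

end Pair

end

end SphericalSynthesis

open SphericalSynthesis

/-!
The pairing `(φ, μ) ↦ (μ * φ)(e)` identifies `C(G//K)` with the continuous dual of `M_c(G//K)`.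
Exponential maximal ideals are the kernels of the characters `μ ↦ (μ * s)(e)` for spherical
functions `s`, and `φ` is a generalized monomial exactly when some power `M ^ (n + 1)` of such an
ideal kills it. Hence every generalized monomial in `V` is killed by the right-hand side of `(*)`,
and if these monomials are dense in `V`, then so is all of `V`.

Conversely, when `M_c(G//K) / M^(n+1)` is finite dimensional, `Ann V + M^(n+1)` is closed, so by
duality it is the set of measures orthogonal to the `φ` it kills; by `Ann Ann V = V` these `φ` are
monomials belonging to `V`. A functional on `C(G)` vanishing on all monomials in `V` is given on
`C(G//K)` by a measure lying in every such sum, hence in `Ann V` by `(*)`, so it vanishes on `V`.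
-/

namespace SphericalSynthesis

noncomputable section

open Ideal (torsionOf)

section SubspacesAndDuals

variable {𝕜 E : Type*} [RCLike 𝕜] [AddCommGroup E] [Module 𝕜 E] [TopologicalSpace E]

theorem mem_topologicalClosure_of_forall_strongDual [IsTopologicalAddGroup E]
    [ContinuousSMul 𝕜 E] [Module ℝ E] [IsScalarTower ℝ 𝕜 E] [LocallyConvexSpace ℝ E]
    {W : Submodule 𝕜 E} {x : E} (h : ∀ L : StrongDual 𝕜 E, (∀ w ∈ W, L w = 0) → L x = 0) :
    x ∈ W.topologicalClosure := by
  by_contra hx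
  obtain ⟨L, u, hLu, hux⟩ := RCLike.geometric_hahn_banach_closed_point (𝕜 := 𝕜)
    (W.topologicalClosure.restrictScalars ℝ).convex W.isClosed_topologicalClosure hx
  have hu : 0 < u := by simpa using hLu 0 (zero_mem _)
  have hL : ∀ w ∈ W, L w = 0 := fun w hw => by
    by_contra hne
    have := hLu (((u : 𝕜) / L w) • w) (Submodule.smul_mem _ _ (W.le_topologicalClosure hw))
    simp [div_mul_cancel₀ _ hne] at this
  rw [h L hL, map_zero] at hux
  exact hu.not_gt hux

theorem mem_of_forall_strongDual_of_finiteDimensional_quotient [IsTopologicalAddGroup E]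
    [ContinuousSMul 𝕜 E] {N P : Submodule 𝕜 E} (hN : IsClosed (N : Set E))
    [FiniteDimensional 𝕜 (E ⧸ N)] (hNP : N ≤ P) {x : E}
    (h : ∀ L : StrongDual 𝕜 E, (∀ w ∈ P, L w = 0) → L x = 0) : x ∈ P := by
  by_contra hx
  obtain ⟨L, hLx, hPL⟩ := Submodule.exists_le_ker_of_notMem hx
  have hL : Continuous L := L.continuous_iff_isClosed_ker.mpr
    (Submodule.isClosed_mono_of_finiteDimensional_quotient hN (hNP.trans hPL))
  exact hLx (h ⟨L, hL⟩ fun w hw => hPL hw)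

theorem exists_forall_eq_apply_weakDual (Φ : StrongDual 𝕜 (WeakDual 𝕜 E)) :
    ∃ x : E, ∀ μ : WeakDual 𝕜 E, Φ μ = μ x := by
  obtain ⟨x, hx⟩ := LinearMap.dualEmbedding_surjective (topDualPairing 𝕜 E) Φ
  exact ⟨x, fun μ => (DFunLike.congr_fun hx μ).symm⟩

end SubspacesAndDuals

section IdealPowers

variable {R : Type*}

theorem list_prod_mem_pow_length [Semiring R] {I : Ideal R} {l : List R} (hl : ∀ a ∈ l, a ∈ I) :
    l.prod ∈ I ^ l.length := by
  induction l with
  | nil => simp [Submodule.pow_zero, Ideal.one_eq_top]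
  | cons a l ih =>
    obtain ⟨ha, hl⟩ := List.forall_mem_cons.mp hl
    rcases eq_or_ne l [] with rfl | hne
    · simpa [Submodule.pow_one] using ha
    · rw [List.prod_cons, List.length_cons, Submodule.pow_succ' I (by simpa using hne)]
      exact Ideal.mul_mem_mul ha (ih hl)

theorem le_of_isMaximal_of_pow_le [Ring R] {M I : Ideal R} (hM : M.IsMaximal) (hI : I ≠ ⊤) {n : ℕ}
    (h : M ^ n ≤ I) : I ≤ M := by
  intro x hx
  by_contra hxM
  obtain ⟨y, i, hi, hyx⟩ := hM.exists_inv hxM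
  have h_sub : 1 - i ∈ I := by simpa [← hyx] using I.mul_mem_left y hx
  have h_sub_pow : 1 - i ^ n ∈ I := by
    simpa [geom_sum_mul_neg] using I.mul_mem_left (∑ j ∈ Finset.range n, i ^ j) h_sub
  refine hI (I.eq_top_iff_one.mpr ?_)
  simpa using I.add_mem h_sub_pow (h (Ideal.pow_mem_pow hi n))

end IdealPowers

section KInvariance

variable {G : Type*} [Group G] [TopologicalSpace G] {K : Subgroup G}

theorem KFun.ext {φ ψ : KFun K} (h : ∀ x, φ.1 x = ψ.1 x) : φ = ψ :=
  Subtype.ext (ContinuousMap.ext h)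

theorem KFun.apply_mul_left {f : C(G, ℂ)} (hf : f ∈ KFun K) (k : K) (x : G) :
    f (k * x) = f x := by
  simpa using hf x k 1

theorem KFun.apply_mul_right {f : C(G, ℂ)} (hf : f ∈ KFun K) (x : G) (k : K) :
    f (x * k) = f x := by
  simpa using hf x 1 k

variable [IsTopologicalGroup G]

/-- The operator `f ↦ (x ↦ f x⁻¹)`; it turns `⟨μ, f⟩` into `(μ * f)(e)`. -/
def reflect : C(G, ℂ) →L[ℂ] C(G, ℂ) where
  toFun f := f.comp ⟨fun x => x⁻¹, by fun_prop⟩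
  map_add' _ _ := rfl
  map_smul' _ _ := rfl
  cont := ContinuousMap.continuous_precomp _

theorem reflect_apply (f : C(G, ℂ)) (x : G) : reflect f x = f x⁻¹ := rfl

theorem reflect_reflect (f : C(G, ℂ)) : reflect (reflect f) = f := by
  ext x
  simp only [reflect_apply, inv_inv]

theorem reflect_mem_KFun {f : C(G, ℂ)} (hf : f ∈ KFun K) : reflect f ∈ KFun K := fun x k l => by
  simpa [reflect_apply, mul_assoc] using hf x⁻¹ l⁻¹ k⁻¹

variable [LocallyCompactSpace G] [T2Space G] [MeasurableSpace G] [BorelSpace G] [CompactSpace K]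

instance : (haarK K).IsHaarMeasure := by
  unfold haarK
  infer_instance

instance : (haarK K).IsMulRightInvariant where
  map_mul_right_eq_self k :=
    have := Measure.isProbabilityMeasure_map (μ := haarK K) (measurable_mul_const k).aemeasurable
    Measure.isHaarMeasure_eq_of_isProbabilityMeasure _ _

instance : (haarK K).IsInvInvariant where
  inv_eq_self :=
    have : IsProbabilityMeasure (haarK K).inv :=
      Measure.isProbabilityMeasure_map measurable_inv.aemeasurable
    have : (haarK K).inv.IsHaarMeasure := { }
    Measure.isHaarMeasure_eq_of_isProbabilityMeasure _ _

theorem leftAvg_mul_left (f : C(G, ℂ)) (k : K) (x : G) :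
    leftAvg K f (k * x) = leftAvg K f x := by
  simpa [leftAvg_apply, mul_assoc] using
    integral_mul_right_eq_self (μ := haarK K) (fun l : K => f (l * x)) k

theorem rightAvg_mul_right (f : C(G, ℂ)) (x : G) (k : K) :
    rightAvg K f (x * k) = rightAvg K f x := by
  simpa [rightAvg_apply, mul_assoc] using
    integral_mul_left_eq_self (μ := haarK K) (fun l : K => f (x * l)) k

theorem leftAvg_comp_mul_left (f : C(G, ℂ)) (k : K) :
    leftAvg K (f.comp ⟨fun x => k * x, by fun_prop⟩) = leftAvg K f := by
  ext x
  simpa [leftAvg_apply, mul_assoc] using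
    integral_mul_left_eq_self (μ := haarK K) (fun l : K => f (l * x)) k

theorem proj_of_mem_KFun {f : C(G, ℂ)} (hf : f ∈ KFun K) : proj K f = f := by
  ext x
  simp [proj_apply, hf x _ _]

theorem proj_mem_KFun (f : C(G, ℂ)) : proj K f ∈ KFun K := fun x k l => by
  change leftAvg K (rightAvg K f) (k * x * l) = leftAvg K (rightAvg K f) x
  rw [leftAvg_rightAvg, rightAvg_mul_right, ← leftAvg_rightAvg, leftAvg_mul_left]

theorem KMeas.apply_comp_mul_left (μ : KMeas K) (f : C(G, ℂ)) (k : K) :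
    (μ : CompactMeasure G) (f.comp ⟨fun x => k * x, by fun_prop⟩) = (μ : CompactMeasure G) f := by
  rw [← KMeas.apply_leftAvg μ, leftAvg_comp_mul_left, KMeas.apply_leftAvg μ]

end KInvariance

section Action

variable {G : Type*} [Group G] [TopologicalSpace G] [IsTopologicalGroup G] [LocallyCompactSpace G]

/-- The continuous operator `f ↦ μ * f` on `C(G)`. -/
def convOp (μ : CompactMeasure G) : C(G, ℂ) →L[ℂ] C(G, ℂ) :=
  slice ⟨fun p : G × G => p.2⁻¹ * p.1, by fun_prop⟩ μ.toFunctional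

theorem convFun_one_eq_apply_reflect (μ : CompactMeasure G) (f : C(G, ℂ)) :
    convFun μ f 1 = μ (reflect f) :=
  congrArg μ (ContinuousMap.ext fun y => congrArg f (mul_one y⁻¹))

variable [T2Space G] [MeasurableSpace G] [BorelSpace G] {K : Subgroup G} [CompactSpace K]

theorem convFun_mem_KFun (μ : KMeas K) {f : C(G, ℂ)} (hf : f ∈ KFun K) :
    convFun (μ : CompactMeasure G) f ∈ KFun K := fun x k l => by
  rw [convFun_apply, convFun_apply, ← KMeas.apply_comp_mul_left μ _ k]
  congr 1
  ext y
  simpa [mul_assoc] using KFun.apply_mul_right hf (y⁻¹ * x) l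

theorem convFun_one {f : C(G, ℂ)} (hf : f ∈ KFun K) :
    convFun ((1 : KMeas K) : CompactMeasure G) f = f := by
  ext x
  have h (k l : K) : f ((l : G)⁻¹ * ((k : G)⁻¹ * x)) = f x := by
    rw [← K.coe_inv, KFun.apply_mul_left hf, ← K.coe_inv, KFun.apply_mul_left hf]
  simp [convFun_apply, KMeas.one_apply, proj_apply, mul_assoc, h]

/-- The action `μ • φ = μ * φ` of `M_c(G//K)` on `C(G//K)`. -/
instance : SMul (KMeas K) (KFun K) where
  smul μ φ := ⟨convFun (μ : CompactMeasure G) φ, convFun_mem_KFun μ φ.2⟩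

theorem coe_smul (μ : KMeas K) (φ : KFun K) :
    ((μ • φ : KFun K) : C(G, ℂ)) = convFun (μ : CompactMeasure G) φ := rfl

instance : Module (KMeas K) (KFun K) where
  one_smul φ := Subtype.ext (convFun_one φ.2)
  mul_smul μ ν φ := Subtype.ext (convFun_mul μ ν φ)
  smul_zero _ := Subtype.ext (convFun_zero _)
  smul_add μ φ ψ := Subtype.ext (map_add (convOp (μ : CompactMeasure G)) φ.1 ψ.1)
  add_smul _ _ _ := rfl
  zero_smul _ := rfl

instance : IsScalarTower ℂ (KMeas K) (KFun K) := ⟨fun _ _ _ => rfl⟩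

instance : SMulCommClass (KMeas K) ℂ (KFun K) := IsScalarTower.to_smulCommClass'

theorem continuous_smul_apply (φ : KFun K) (x : G) :
    Continuous fun μ : KMeas K => (μ • φ : KFun K).1 x :=
  (WeakDual.eval_continuous (𝕜 := ℂ) (E := C(G, ℂ)) _).comp continuous_subtype_val

theorem IsGelfandPair.smul_comm (hK : IsGelfandPair K) (μ ν : KMeas K) (φ : KFun K) :
    μ • ν • φ = ν • μ • φ := by
  rw [← mul_smul, hK, mul_smul]

theorem deltaK_inv_smul_apply (y : G) (φ : KFun K) (x : G) :
    (deltaK K y⁻¹ • φ : KFun K).1 x = ∫ k : K, φ.1 (y * k * x) ∂(haarK K) := by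
  have h (k l : K) : φ.1 ((l : G)⁻¹ * (y * ((k : G)⁻¹ * x))) = φ.1 (y * ((k : G)⁻¹ * x)) := by
    rw [← K.coe_inv l, KFun.apply_mul_left φ.2]
  rw [← integral_inv_eq_self _ (haarK K)]
  simp [coe_smul, convFun_apply, deltaK_apply, proj_apply, mul_assoc, h]

/-- The duality pairing `μ ↦ (μ * φ)(e)` between `C(G//K)` and `M_c(G//K)`. -/
def pairing (φ : KFun K) : StrongDual ℂ (KMeas K) where
  toFun μ := (μ • φ : KFun K).1 1
  map_add' _ _ := rfl
  map_smul' _ _ := rfl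
  cont := continuous_smul_apply φ 1

theorem pairing_apply (φ : KFun K) (μ : KMeas K) : pairing φ μ = (μ • φ : KFun K).1 1 := rfl

theorem pairing_smul (φ : KFun K) (μ ν : KMeas K) : pairing (μ • φ) ν = pairing φ (ν * μ) := by
  rw [pairing_apply, pairing_apply, mul_smul]

theorem pairing_deltaK_inv (φ : KFun K) (x : G) : pairing φ (deltaK K x⁻¹) = φ.1 x := by
  rw [pairing_apply, deltaK_inv_smul_apply]
  simp [KFun.apply_mul_right φ.2]

theorem smul_apply_eq_pairing (μ : KMeas K) (φ : KFun K) (x : G) :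
    (μ • φ : KFun K).1 x = pairing φ (deltaK K x⁻¹ * μ) := by
  rw [← pairing_deltaK_inv, pairing_smul]

theorem le_torsionOf_of_forall_pairing_eq_zero {I : Ideal (KMeas K)} {φ : KFun K}
    (h : ∀ μ ∈ I, pairing φ μ = 0) : I ≤ torsionOf (KMeas K) (KFun K) φ := by
  intro μ hμ
  refine (Ideal.mem_torsionOf_iff φ μ).mpr (KFun.ext fun x => ?_)
  rw [smul_apply_eq_pairing]
  exact h _ (I.mul_mem_left _ hμ)

theorem isClosed_torsionOf (φ : KFun K) :
    IsClosed (torsionOf (KMeas K) (KFun K) φ : Set (KMeas K)) := by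
  have h : (torsionOf (KMeas K) (KFun K) φ : Set (KMeas K))
      = ⋂ x : G, {μ | (μ • φ : KFun K).1 x = 0} := by
    ext μ
    rw [SetLike.mem_coe, Ideal.mem_torsionOf_iff, Set.mem_iInter]
    exact ⟨fun h x => by rw [Set.mem_ofPred_eq, h]; rfl, fun h => KFun.ext h⟩
  rw [h]
  exact isClosed_iInter fun x => isClosed_eq (continuous_smul_apply φ x) continuous_const

theorem closedPower_le_torsionOf {M : Ideal (KMeas K)} {n : ℕ} {φ : KFun K}
    (h : M ^ n ≤ torsionOf (KMeas K) (KFun K) φ) :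
    closedPower M n ≤ (torsionOf (KMeas K) (KFun K) φ).restrictScalars ℂ :=
  Submodule.topologicalClosure_minimal _ h (isClosed_torsionOf φ)

theorem annihilator_le_torsionOf {V : Submodule ℂ C(G, ℂ)} {φ : KFun K} (hφ : φ.1 ∈ V) :
    annihilator K V ≤ torsionOf (KMeas K) (KFun K) φ := fun _ hμ => Subtype.ext (hμ φ hφ)

end Action

section Duality

variable {G : Type*} [Group G] [TopologicalSpace G] [IsTopologicalGroup G] [LocallyCompactSpace G]
  [T2Space G] [MeasurableSpace G] [BorelSpace G] {K : Subgroup G} [CompactSpace K]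

/-- The `K`-invariant measure whose pairing with `C(G//K)` is the restriction of a given continuous
functional on `C(G)`. -/
def dualMeas (L : StrongDual ℂ C(G, ℂ)) : KMeas K :=
  ⟨measProj K (.of (L.comp reflect)), measProj_mem _⟩

theorem pairing_dualMeas (L : StrongDual ℂ C(G, ℂ)) (φ : KFun K) :
    pairing φ (dualMeas L) = L φ := by
  rw [pairing_apply, coe_smul, convFun_one_eq_apply_reflect]
  change L (reflect (proj K (reflect φ))) = L φ
  rw [proj_of_mem_KFun (reflect_mem_KFun φ.2), reflect_reflect]

theorem dualMeas_mem_annihilator (hK : IsGelfandPair K) {V : Submodule ℂ C(G, ℂ)}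
    (hV : IsVariety K V) {L : StrongDual ℂ C(G, ℂ)} (hL : ∀ f ∈ V, L f = 0) :
    dualMeas L ∈ annihilator K V := by
  intro f hf
  lift f to KFun K using hV.le_KFun hf
  ext x
  rw [← coe_smul, smul_apply_eq_pairing, hK, ← pairing_smul, pairing_dualMeas]
  exact hL _ (hV.translate_mem f hf x)

theorem IsVariety.mem_of_annihilator_le_torsionOf (hK : IsGelfandPair K)
    {V : Submodule ℂ C(G, ℂ)} (hV : IsVariety K V) {φ : KFun K}
    (hφ : annihilator K V ≤ torsionOf (KMeas K) (KFun K) φ) : φ.1 ∈ V := by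
  rw [← hV.isClosed.submodule_topologicalClosure_eq]
  refine mem_topologicalClosure_of_forall_strongDual fun L hL => ?_
  rw [← pairing_dualMeas, pairing_apply,
    (Ideal.mem_torsionOf_iff φ _).mp (hφ (dualMeas_mem_annihilator hK hV hL))]
  rfl

variable (K) in
/-- The projection `μ ↦ μ^#` of `M_c(G)` onto `M_c(G//K)`. -/
def measProjL : CompactMeasure G →L[ℂ] KMeas K where
  toFun μ := ⟨measProj K μ, measProj_mem μ⟩
  map_add' _ _ := rfl
  map_smul' _ _ := rfl
  cont := Continuous.subtype_mk
    (WeakDual.continuous_of_continuous_eval (𝕜 := ℂ) (E := C(G, ℂ)) fun f =>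
      WeakDual.eval_continuous (𝕜 := ℂ) (E := C(G, ℂ)) (proj K f)) _

theorem measProjL_coe (μ : KMeas K) : measProjL K μ = μ :=
  KMeas.ext_apply fun f => KMeas.apply_proj μ f

theorem pairing_surjective :
    Function.Surjective (pairing : KFun K → StrongDual ℂ (KMeas K)) := fun Φ => by
  obtain ⟨g, hg⟩ := exists_forall_eq_apply_weakDual (E := C(G, ℂ)) (Φ.comp (measProjL K))
  refine ⟨⟨reflect (proj K g), reflect_mem_KFun (proj_mem_KFun g)⟩, ContinuousLinearMap.ext ?_⟩
  intro μ
  rw [pairing_apply, coe_smul, convFun_one_eq_apply_reflect, reflect_reflect, KMeas.apply_proj]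
  exact (hg μ.1).symm.trans (congrArg Φ (measProjL_coe μ))

theorem mem_of_forall_pairing_eq_zero {N P : Submodule ℂ (KMeas K)}
    (hN : IsClosed (N : Set (KMeas K))) [FiniteDimensional ℂ (KMeas K ⧸ N)] (hNP : N ≤ P)
    {μ : KMeas K} (h : ∀ φ : KFun K, (∀ ν ∈ P, pairing φ ν = 0) → pairing φ μ = 0) : μ ∈ P :=
  mem_of_forall_strongDual_of_finiteDimensional_quotient hN hNP (pairing_surjective.forall.mpr h)

end Duality

section SphericalFunctions

variable {G : Type*} [Group G] [TopologicalSpace G] [IsTopologicalGroup G] [MeasurableSpace G]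
  [BorelSpace G] {K : Subgroup G} [CompactSpace K] {s : C(G, ℂ)}

theorem IsSpherical.apply_one (hs : IsSpherical K s) : s 1 = 1 := by
  obtain ⟨x, hx⟩ := DFunLike.ne_iff.mp hs.ne_zero
  have h : s x = s x * s 1 := by
    rw [← hs.integral_eq]
    simp [KFun.apply_mul_right hs.mem_KFun]
  exact (mul_eq_left₀ hx).mp h.symm

/-- A spherical function as an element of the `M_c(G//K)`-module `C(G//K)`. -/
def IsSpherical.toKFun (hs : IsSpherical K s) : KFun K := ⟨s, hs.mem_KFun⟩

variable [LocallyCompactSpace G] [T2Space G]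

theorem IsSpherical.leftAvg_comp_inv_mul (hs : IsSpherical K s) (x : G) :
    leftAvg K (s.comp ⟨fun y => y⁻¹ * x, by fun_prop⟩) = s x • reflect s := by
  ext y
  rw [leftAvg_apply, ← integral_inv_eq_self _ (haarK K)]
  simpa [reflect_apply, mul_comm (s x)] using hs.integral_eq y⁻¹ x

theorem IsSpherical.smul_toKFun (hs : IsSpherical K s) (μ : KMeas K) :
    μ • hs.toKFun = pairing hs.toKFun μ • hs.toKFun := by
  refine KFun.ext fun x => ?_
  rw [coe_smul, convFun_apply, ← KMeas.apply_leftAvg]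
  change μ.1 (leftAvg K (s.comp ⟨fun y => y⁻¹ * x, by fun_prop⟩)) = _
  rw [hs.leftAvg_comp_inv_mul, map_smul, ← convFun_one_eq_apply_reflect]
  exact mul_comm (s x) _

/-- The character `μ ↦ (μ * s)(e)` of `M_c(G//K)` attached to a spherical function `s`. -/
def IsSpherical.char (hs : IsSpherical K s) : KMeas K →ₐ[ℂ] ℂ :=
  AlgHom.ofLinearMap (pairing hs.toKFun : KMeas K →ₗ[ℂ] ℂ)
    (by
      change pairing hs.toKFun 1 = 1
      rw [pairing_apply, one_smul]
      exact hs.apply_one)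
    fun μ ν => by
      change pairing hs.toKFun (μ * ν) = pairing hs.toKFun μ * pairing hs.toKFun ν
      rw [← pairing_smul, hs.smul_toKFun, pairing_apply, smul_comm]
      exact mul_comm (pairing hs.toKFun ν) _

theorem isExponential_ker {Φ : KMeas K →ₐ[ℂ] ℂ} (hΦ : Continuous Φ) :
    IsExponential (RingHom.ker Φ) :=
  have h_surj : Function.Surjective Φ := fun c => ⟨algebraMap ℂ (KMeas K) c, Φ.commutes c⟩
  ⟨RingHom.ker_isMaximal_of_surjective Φ h_surj, Φ, hΦ, h_surj, rfl⟩

theorem IsSpherical.isExponential_ker_char (hs : IsSpherical K s) :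
    IsExponential (RingHom.ker (hs.char)) :=
  isExponential_ker (pairing hs.toKFun).continuous

theorem IsExponential.exists_isSpherical {M : Ideal (KMeas K)} (hM : IsExponential M) :
    ∃ s : C(G, ℂ), IsSpherical K s ∧ ∀ y, sphDiff K s y ∈ M := by
  obtain ⟨-, Φ, hΦ, -, rfl⟩ := hM
  obtain ⟨s, hs⟩ := pairing_surjective ⟨Φ.toLinearMap, hΦ⟩
  replace hs (μ : KMeas K) : pairing s μ = Φ μ := DFunLike.congr_fun hs μ
  have h_delta (x : G) : Φ (deltaK K x⁻¹) = s.1 x := by rw [← hs, pairing_deltaK_inv]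
  refine ⟨s.1, ⟨s.2, fun h0 => ?_, fun x y => ?_⟩, fun y => ?_⟩
  · have h_one : pairing s 1 = 1 := by rw [hs, map_one]
    rw [pairing_apply, one_smul, h0] at h_one
    exact zero_ne_one h_one
  · rw [← deltaK_inv_smul_apply, smul_apply_eq_pairing, hs, map_mul, h_delta, h_delta, mul_comm]
  · simp [RingHom.mem_ker, sphDiff, h_delta]

end SphericalFunctions

section Monomials

variable {G : Type*} [Group G] [TopologicalSpace G] [IsTopologicalGroup G] [LocallyCompactSpace G]
  [T2Space G] [MeasurableSpace G] [BorelSpace G] {K : Subgroup G} [CompactSpace K]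

theorem sphDiff_smul (s : C(G, ℂ)) (y : G) (φ : KFun K) :
    sphDiff K s y • φ = deltaK K y⁻¹ • φ - s y • φ := by
  refine (sub_smul _ _ φ).trans ?_
  rw [smul_assoc, one_smul]

theorem IsSpherical.eq_smul_of_forall_sphDiff_smul_eq_zero {s : C(G, ℂ)} (hs : IsSpherical K s)
    {φ : KFun K} (h : ∀ y, sphDiff K s y • φ = 0) : φ = φ.1 1 • hs.toKFun := by
  refine KFun.ext fun y => ?_
  have hy : deltaK K y⁻¹ • φ = s y • φ := sub_eq_zero.mp ((sphDiff_smul s y φ).symm.trans (h y))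
  rw [← pairing_deltaK_inv, pairing_apply, hy]
  exact mul_comm (s y) _

theorem IsSpherical.ker_char_pow_le_torsionOf (hK : IsGelfandPair K) {s : C(G, ℂ)}
    (hs : IsSpherical K s) {n : ℕ} {φ : KFun K}
    (h : ∀ y : Fin n → G, (List.ofFn fun i => sphDiff K s (y i)).prod • φ = 0) :
    RingHom.ker (hs.char) ^ n ≤ torsionOf (KMeas K) (KFun K) φ := by
  induction n generalizing φ with
  | zero =>
    have hφ : φ = 0 := by simpa using h ![]
    simp [hφ]
  | succ n ih =>
    rw [Submodule.pow_succ, Ideal.mul_le]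
    intro ν hν μ hμ
    rw [Ideal.mem_torsionOf_iff, mul_smul, ← Ideal.mem_torsionOf_iff]
    refine ih (fun y => ?_) hν
    -- `n` differences map `φ` into the joint kernel `ℂ s` of the differences, which `μ` kills.
    set ψ := (List.ofFn fun i => sphDiff K s (y i)).prod • φ with hψ
    have h_diff (z : G) : sphDiff K s z • ψ = 0 := by
      rw [hψ, ← mul_smul]
      simpa [List.ofFn_succ] using h (Fin.cons z y)
    have hμs : μ • hs.toKFun = 0 := by
      have h_char : pairing hs.toKFun μ = 0 := hμ
      rw [hs.smul_toKFun, h_char, zero_smul]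
    rw [hK.smul_comm, ← hψ, hs.eq_smul_of_forall_sphDiff_smul_eq_zero h_diff, smul_comm, hμs,
      smul_zero]

theorem isGenMonomial_iff (hK : IsGelfandPair K) (φ : KFun K) :
    IsGenMonomial K φ.1 ↔ ∃ M : Ideal (KMeas K), IsExponential M ∧
      ∃ n : ℕ, M ^ (n + 1) ≤ torsionOf (KMeas K) (KFun K) φ := by
  constructor
  · rintro ⟨-, s, hs, n, h⟩
    exact ⟨_, hs.isExponential_ker_char, n,
      hs.ker_char_pow_le_torsionOf hK fun y => Subtype.ext (h y)⟩
  · rintro ⟨M, hM, n, h⟩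
    obtain ⟨s, hs, hsM⟩ := hM.exists_isSpherical
    refine ⟨φ.2, s, hs, n, fun y => congrArg Subtype.val ((Ideal.mem_torsionOf_iff φ _).mp (h ?_))⟩
    simpa using list_prod_mem_pow_length (List.forall_mem_ofFn_iff.mpr fun i => hsM (y i))

theorem generated_le {V : Submodule ℂ C(G, ℂ)} (hV : IsVariety K V) {f : C(G, ℂ)} (hf : f ∈ V) :
    generated K f ≤ V :=
  sInf_le ⟨hV, hf⟩

/-- The linear map `μ ↦ μ * φ` from `M_c(G//K)` to `C(G)`. -/
def orbitMap (φ : KFun K) : KMeas K →ₗ[ℂ] C(G, ℂ) :=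
  (KFun K).subtype ∘ₗ (LinearMap.toSpanSingleton (KMeas K) (KFun K) φ).restrictScalars ℂ

theorem isVariety_range_orbitMap (φ : KFun K) [FiniteDimensional ℂ (LinearMap.range (orbitMap φ))] :
    IsVariety K (LinearMap.range (orbitMap φ)) where
  le_KFun := by
    rintro _ ⟨μ, rfl⟩
    exact (μ • φ).2
  isClosed := Submodule.closed_of_finiteDimensional _
  translate_mem := by
    rintro _ ⟨μ, rfl⟩ y
    exact ⟨deltaK K y⁻¹ * μ, congrArg Subtype.val (mul_smul _ μ φ)⟩

theorem finiteDimensional_generated {N : Submodule ℂ (KMeas K)}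
    [FiniteDimensional ℂ (KMeas K ⧸ N)] {φ : KFun K}
    (h : N ≤ (torsionOf (KMeas K) (KFun K) φ).restrictScalars ℂ) :
    FiniteDimensional ℂ (generated K φ.1) := by
  have h_ker : N ≤ LinearMap.ker (orbitMap φ) := fun μ hμ => congrArg Subtype.val (h hμ)
  have : FiniteDimensional ℂ (LinearMap.range (orbitMap φ)) := by
    rw [← N.range_liftQ _ h_ker]
    infer_instance
  exact Submodule.finiteDimensional_of_le
    (generated_le (isVariety_range_orbitMap φ) ⟨1, congrArg Subtype.val (one_smul (KMeas K) φ)⟩)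

end Monomials

section Synthesis

variable {G : Type*} [Group G] [TopologicalSpace G] [IsTopologicalGroup G] [LocallyCompactSpace G]
  [T2Space G] [MeasurableSpace G] [BorelSpace G] {K : Subgroup G} [CompactSpace K]

theorem IsGenMonomial.iInf_sup_closedPower_le_torsionOf (hK : IsGelfandPair K)
    {I : Ideal (KMeas K)} {φ : KFun K} (hφ : IsGenMonomial K φ.1)
    (hI : I ≤ torsionOf (KMeas K) (KFun K) φ) :
    ⨅ (M : Ideal (KMeas K)) (_ : IsExponential M) (_ : I ≤ M) (n : ℕ),
        I.restrictScalars ℂ ⊔ closedPower M (n + 1)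
      ≤ (torsionOf (KMeas K) (KFun K) φ).restrictScalars ℂ := by
  obtain ⟨M, hM, n, hMn⟩ := (isGenMonomial_iff hK φ).mp hφ
  by_cases h_top : torsionOf (KMeas K) (KFun K) φ = ⊤
  · simp [h_top]
  · have hIM : I ≤ M := hI.trans (le_of_isMaximal_of_pow_le hM.1 h_top hMn)
    exact iInf_le_of_le M <| iInf_le_of_le hM <| iInf_le_of_le hIM <| iInf_le_of_le n <|
      sup_le hI (closedPower_le_torsionOf hMn)

theorem IsSynthesizable.annihilator_eq_iInf (hK : IsGelfandPair K) {V : Submodule ℂ C(G, ℂ)}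
    (hV : IsSynthesizable K V) :
    (annihilator K V).restrictScalars ℂ =
      ⨅ (M : Ideal (KMeas K)) (_ : IsExponential M) (_ : annihilator K V ≤ M) (n : ℕ),
        (annihilator K V).restrictScalars ℂ ⊔ closedPower M (n + 1) := by
  refine le_antisymm
    (le_iInf fun _ => le_iInf fun _ => le_iInf fun _ => le_iInf fun _ => le_sup_left)
    fun μ hμ f hf => ?_
  have h_span : Submodule.span ℂ {φ | φ ∈ V ∧ IsMonomial K φ}
      ≤ LinearMap.ker (convOp (μ : CompactMeasure G)).toLinearMap := by
    rw [Submodule.span_le]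
    rintro φ ⟨hφV, hφ, -⟩
    lift φ to KFun K using hφ.mem_KFun
    exact congrArg Subtype.val
      (hφ.iInf_sup_closedPower_le_torsionOf hK (annihilator_le_torsionOf hφV) hμ)
  exact Submodule.topologicalClosure_minimal _ h_span
    (convOp (μ : CompactMeasure G)).isClosed_ker (hV hf)

theorem mem_sup_closedPower_of_forall_isMonomial (hK : IsGelfandPair K) {M : Ideal (KMeas K)}
    (hM : IsExponential M) {n : ℕ} [FiniteDimensional ℂ (KMeas K ⧸ closedPower M (n + 1))]
    {I : Ideal (KMeas K)} {μ : KMeas K}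
    (h : ∀ φ : KFun K, IsMonomial K φ.1 → I ≤ torsionOf (KMeas K) (KFun K) φ → pairing φ μ = 0) :
    μ ∈ I.restrictScalars ℂ ⊔ closedPower M (n + 1) := by
  refine mem_of_forall_pairing_eq_zero (N := closedPower M (n + 1))
    (Submodule.isClosed_topologicalClosure _) le_sup_right
    fun φ hφ => ?_
  have hI : I ≤ torsionOf (KMeas K) (KFun K) φ :=
    le_torsionOf_of_forall_pairing_eq_zero fun ν hν => hφ ν (Submodule.mem_sup_left hν)
  have hM_pow : M ^ (n + 1) ≤ torsionOf (KMeas K) (KFun K) φ :=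
    le_torsionOf_of_forall_pairing_eq_zero fun ν hν =>
      hφ ν (Submodule.mem_sup_right (Submodule.le_topologicalClosure _ hν))
  exact h φ ⟨(isGenMonomial_iff hK φ).mpr ⟨M, hM, n, hM_pow⟩,
    finiteDimensional_generated (closedPower_le_torsionOf hM_pow)⟩ hI

theorem IsVariety.isSynthesizable_of_iInf_le_annihilator (hK : IsGelfandPair K)
    {V : Submodule ℂ C(G, ℂ)} (hV : IsVariety K V)
    (h : ⨅ (M : Ideal (KMeas K)) (_ : IsExponential M) (_ : annihilator K V ≤ M) (n : ℕ)
          (_ : FiniteDimensional ℂ (KMeas K ⧸ closedPower M (n + 1))),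
          (annihilator K V).restrictScalars ℂ ⊔ closedPower M (n + 1)
        ≤ (annihilator K V).restrictScalars ℂ) :
    IsSynthesizable K V := by
  intro f hf
  refine mem_topologicalClosure_of_forall_strongDual fun L hL => ?_
  have h_mono (φ : KFun K) (hφ : IsMonomial K φ.1)
      (hφV : annihilator K V ≤ torsionOf (KMeas K) (KFun K) φ) : pairing φ (dualMeas L) = 0 := by
    rw [pairing_dualMeas]
    exact hL _ (Submodule.subset_span ⟨hV.mem_of_annihilator_le_torsionOf hK hφV, hφ⟩)
  have h_mem : dualMeas L ∈ annihilator K V := h <| by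
    simp only [Submodule.mem_iInf]
    intro M hM _ n _
    exact mem_sup_closedPower_of_forall_isMonomial hK hM h_mono
  lift f to KFun K using hV.le_KFun hf
  rw [← pairing_dualMeas]
  exact DFunLike.congr_fun (h_mem f.1 hf) 1

end Synthesis

end

end SphericalSynthesis

theorem mainTheorem7 {G : Type*} [Group G] [TopologicalSpace G] [IsTopologicalGroup G]
    [LocallyCompactSpace G] [T2Space G] [MeasurableSpace G] [BorelSpace G]
    (K : Subgroup G) [CompactSpace K] (hGK : IsGelfandPair K)
    (V : Submodule ℂ C(G, ℂ)) (hV : IsVariety K V) (hV0 : V ≠ ⊥) :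
    -- the equivalence, when the quotients `M_c(G//K) / M^(n+1)` are finite dimensional
    ((∀ M : Ideal (KMeas K), IsExponential M → annihilator K V ≤ M →
        ∀ n : ℕ, FiniteDimensional ℂ (KMeas K ⧸ closedPower M (n + 1))) →
      (IsSynthesizable K V ↔
        (annihilator K V).restrictScalars ℂ =
          ⨅ (M : Ideal (KMeas K)) (_ : IsExponential M) (_ : annihilator K V ≤ M) (n : ℕ),
            (annihilator K V).restrictScalars ℂ ⊔ closedPower M (n + 1))) ∧
    -- necessity, without any assumption on the quotients
    (IsSynthesizable K V →
      (annihilator K V).restrictScalars ℂ =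
        ⨅ (M : Ideal (KMeas K)) (_ : IsExponential M) (_ : annihilator K V ≤ M) (n : ℕ),
          (annihilator K V).restrictScalars ℂ ⊔ closedPower M (n + 1)) ∧
    -- sufficiency, with the intersection restricted to the finite dimensional quotients
    ((annihilator K V).restrictScalars ℂ =
        ⨅ (M : Ideal (KMeas K)) (_ : IsExponential M) (_ : annihilator K V ≤ M) (n : ℕ)
          (_ : FiniteDimensional ℂ (KMeas K ⧸ closedPower M (n + 1))),
          (annihilator K V).restrictScalars ℂ ⊔ closedPower M (n + 1) →
      IsSynthesizable K V) := by
  refine ⟨fun hfin => ⟨fun h => h.annihilator_eq_iInf hGK, fun h => ?_⟩,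
    fun h => h.annihilator_eq_iInf hGK,
    fun h => hV.isSynthesizable_of_iInf_le_annihilator hGK h.ge⟩
  refine hV.isSynthesizable_of_iInf_le_annihilator hGK (le_trans ?_ h.ge)
  exact iInf_mono fun M => iInf_mono fun hM => iInf_mono fun hle => iInf_mono fun n =>
    iInf_le_of_le (hfin M hM hle n) le_rfl
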